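/- Let $(\Omega,g)$ be a smooth $n$-dimensional Riemannian manifold (possibly with smooth boundary) and let $f\in C^3(\Omega)$. In any local coordinates $x_1,\dots,x_n$ write $g_{jk}$ for the components of the metric, $[g^{jk}]=[g_{jk}]^{-1}$, $|g|=\det[g_{jk}]$, and $\Gamma^j_{lk}=\frac12 g^{jm}\big(\frac{\partial g_{km}}{\partial x_l}+\frac{\partial g_{lm}}{\partial x_k}-\frac{\partial g_{lk}}{\partial x_m}\big)$ (repeated indices are summed from $1$ to $n$). For a function $u$ put $$(\nabla_g u)^j=g^{jl}\frac{\partial u}{\partial x_l},\qquad \Delta_g u=\operatorname{div}\nabla_g u=\frac1{\sqrt{|g|}}\frac{\partial}{\partial x_j}\Big(\sqrt{|g|}\,g^{jk}\frac{\partial u}{\partial x_k}\Big).$$ For a vector field $X=X^j\frac{\partial}{\partial x_j}$ let $\Delta_g X$ be the vector field given by the trace of its second covariant derivative, $$(\Delta_g X)^j=X^{j;k}{}_{;k},\qquad X^{j;m}=g^{ml}X^j{}_{;l},\qquad X^j{}_{;l}=\frac{\partial X^j}{\partial x_l}+\Gamma^j_{sl}X^s,$$ where $T^{jm}{}_{;k}=\frac{\partial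 T^{jm}}{\partial x_k}+\Gamma^j_{sk}T^{sm}+\Gamma^m_{sk}T^{js}$ for a tensor field $T$ of type $(2,0)$. Let $R^j{}_{klm}$ be the $j$-th component of $\mathcal R\big(\frac{\partial}{\partial x_l},\frac{\partial}{\partial x_m}\big)\frac{\partial}{\partial x_k}$, where $\mathcal R(X,Y)Z=\nabla_X\nabla_YZ-\nabla_Y\nabla_XZ-\nabla_{[X,Y]}Z$ for the Levi-Civita connection $\nabla$, and let $R_{jk}=R^l{}_{jlk}$ and $R_l{}^j=g^{jm}R_{lm}$ be the Ricci curvature. Then, in every local coordinate system, at every point of its domain and for every $j=1,\dots,n$, $$\big(\Delta_g(\nabla_g f)\big)^j=\big(\nabla_g(\Delta_g f)\big)^j+R_l{}^{j}\,(\nabla_g f)^l .$$ -/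

import Mathlib

open scoped Manifold ContDiff Bundle

noncomputable section

namespace RiemannCoord

/-! ### Tensor calculus in a coordinate domain

`S` is a coordinate domain in `ℝⁿ` (relatively open in a half space if the manifold has a boundary;
derivatives are taken within `S`), and `G y` is the matrix `[g_{jk}(y)]` of the metric at the point
with coordinates `y`. Scalar functions and the components of tensor fields are functions of the
coordinates. -/

variable {n : ℕ} (S : Set (EuclideanSpace ℝ (Fin n)))
  (G : EuclideanSpace ℝ (Fin n) → Matrix (Fin n) (Fin n) ℝ)

/-- The partial derivative `∂u/∂x_k`. -/
def pd (k : Fin n) (u : EuclideanSpace ℝ (Fin n) → ℝ) (y : EuclideanSpace ℝ (Fin n)) : ℝ :=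
  fderivWithin ℝ u S y (EuclideanSpace.single k 1)

/-- The entry `g^{jk}` of the inverse of the matrix `[g_{jk}]`. -/
def ginv (j k : Fin n) (y : EuclideanSpace ℝ (Fin n)) : ℝ :=
  (G y)⁻¹ j k

/-- The Christoffel symbol
`Γ^j_{lk} = ½ g^{jm} (∂g_{km}/∂x_l + ∂g_{lm}/∂x_k - ∂g_{lk}/∂x_m)`. -/
def christoffel (j l k : Fin n) (y : EuclideanSpace ℝ (Fin n)) : ℝ :=
  (1 / 2) * ∑ m, ginv G j m y *
    (pd S l (fun z => G z k m) y + pd S k (fun z => G z l m) y - pd S m (fun z => G z l k) y)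

/-- The gradient of a function, `(∇_g u)^j = g^{jl} ∂u/∂x_l`. -/
def grad (u : EuclideanSpace ℝ (Fin n) → ℝ) (j : Fin n) (y : EuclideanSpace ℝ (Fin n)) : ℝ :=
  ∑ l, ginv G j l y * pd S l u y

/-- The divergence of a vector field, `div X = |g|^{-1/2} ∂(|g|^{1/2} X^j)/∂x_j`. -/
def divergence (X : Fin n → EuclideanSpace ℝ (Fin n) → ℝ) (y : EuclideanSpace ℝ (Fin n)) : ℝ :=
  (1 / √(G y).det) * ∑ j, pd S j (fun z => √(G z).det * X j z) y

/-- The Laplace-Beltrami operator on functions, `Δ_g u = div ∇_g u`. -/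
def laplaceBeltrami (u : EuclideanSpace ℝ (Fin n) → ℝ) (y : EuclideanSpace ℝ (Fin n)) : ℝ :=
  divergence S G (grad S G u) y

/-- The Levi-Civita covariant derivative of a vector field in the direction of `∂/∂x_k`:
`(∇_{∂/∂x_k} X)^j = X^j_{;k} = ∂X^j/∂x_k + Γ^j_{lk} X^l`. -/
def covDeriv (k : Fin n) (X : Fin n → EuclideanSpace ℝ (Fin n) → ℝ) (j : Fin n)
    (y : EuclideanSpace ℝ (Fin n)) : ℝ :=
  pd S k (X j) y + ∑ l, christoffel S G j l k y * X l y

/-- The covariant derivative of a tensor field of type `(2,0)`: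
`T^{jm}_{;k} = ∂T^{jm}/∂x_k + Γ^j_{lk} T^{lm} + Γ^m_{lk} T^{jl}`. -/
def covDeriv₂ (k : Fin n) (T : Fin n → Fin n → EuclideanSpace ℝ (Fin n) → ℝ) (j m : Fin n)
    (y : EuclideanSpace ℝ (Fin n)) : ℝ :=
  pd S k (T j m) y + ∑ l, christoffel S G j l k y * T l m y
    + ∑ l, christoffel S G m l k y * T j l y

/-- The covariant derivative of a vector field with the new index raised,
`X^{j;m} = g^{ml} X^j_{;l}`. -/
def covDerivUp (X : Fin n → EuclideanSpace ℝ (Fin n) → ℝ) (j m : Fin n)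
    (y : EuclideanSpace ℝ (Fin n)) : ℝ :=
  ∑ l, ginv G m l y * covDeriv S G l X j y

/-- The Laplacian on vector fields, `(Δ_g X)^j = X^{j;k}_{;k}`, that is, the trace of the second
covariant derivative of `X`. -/
def vectorLaplacian (X : Fin n → EuclideanSpace ℝ (Fin n) → ℝ) (j : Fin n)
    (y : EuclideanSpace ℝ (Fin n)) : ℝ :=
  ∑ k, covDeriv₂ S G k (covDerivUp S G X) j k y

/-- The components of the coordinate vector field `∂/∂x_k`. -/
def coordField (k : Fin n) (j : Fin n) (_ : EuclideanSpace ℝ (Fin n)) : ℝ :=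
  if j = k then 1 else 0

/-- The Riemann tensor `R^j_{klm}`: the `j`-th component of
`𝓡(∂/∂x_l, ∂/∂x_m) ∂/∂x_k`, where `𝓡(X, Y) Z = ∇_X ∇_Y Z - ∇_Y ∇_X Z - ∇_{[X, Y]} Z`; the
coordinate fields commute, so that the last term vanishes. -/
def riemann (j k l m : Fin n) (y : EuclideanSpace ℝ (Fin n)) : ℝ :=
  covDeriv S G l (covDeriv S G m (coordField k)) j y
    - covDeriv S G m (covDeriv S G l (coordField k)) j y

/-- The Ricci tensor `R_{jk} = R^l_{jlk}`. -/
def ricci (j k : Fin n) (y : EuclideanSpace ℝ (Fin n)) : ℝ :=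
  ∑ l, riemann S G l j l k y

/-- The Ricci tensor with one index raised, `R_l^j = g^{jm} R_{lm}`. -/
def ricciUp (l j : Fin n) (y : EuclideanSpace ℝ (Fin n)) : ℝ :=
  ∑ m, ginv G j m y * ricci S G l m y

end RiemannCoord

/-! ### Coordinates on a Riemannian manifold -/

section Manifold

variable {n : ℕ} {H : Type*} [TopologicalSpace H]
  {I : ModelWithCorners ℝ (EuclideanSpace ℝ (Fin n)) H}
  {M : Type*} [TopologicalSpace M] [ChartedSpace H M] [IsManifold I ∞ M]

/-- The matrix `g_{jk} = g(∂/∂x_j, ∂/∂x_k)` of the metric in the chart `φ`, as a function of the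
coordinates `x = φ.extend I`. The coordinate vector field `∂/∂x_j` is the image of the `j`-th
standard basis vector of `ℝⁿ` under the differential of the inverse of the chart. -/
def metricMatrix
    (g : Bundle.ContMDiffRiemannianMetric I ∞ (EuclideanSpace ℝ (Fin n))
      (fun p : M => TangentSpace I p))
    (φ : OpenPartialHomeomorph M H) (y : EuclideanSpace ℝ (Fin n)) :
    Matrix (Fin n) (Fin n) ℝ :=
  Matrix.of fun j k =>
    g.inner ((φ.extend I).symm y)
      (mfderivWithin 𝓘(ℝ, EuclideanSpace ℝ (Fin n)) I (φ.extend I).symm (φ.extend I).target y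
        (EuclideanSpace.single j (1 : ℝ) : EuclideanSpace ℝ (Fin n)))
      (mfderivWithin 𝓘(ℝ, EuclideanSpace ℝ (Fin n)) I (φ.extend I).symm (φ.extend I).target y
        (EuclideanSpace.single k (1 : ℝ) : EuclideanSpace ℝ (Fin n)))

end Manifold

end

/-! Put `X = ∇u`. The Hessian of `u` is symmetric, since partial derivatives commute and the
connection is torsion-free; hence `X^{j;k} = X^{k;j}` (`covDerivUp_grad_symm`). As the inverse
metric is parallel (`pd_ginv`), `X^{j;k}_{;k} = X^{k;j}_{;k} = g^{jl} X^k_{;lk}`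
(`vectorLaplacian_eq_of_symm`). The Ricci identity (`covDeriv_comm`) exchanges the two derivatives:
`X^k_{;lk} = X^k_{;kl} + R^k_{skl} X^s`. The curvature term contracts to Ricci, and `X^k_{;k}` is
`Δu` by `divergence_eq`, which rests on Jacobi's formula for the derivative of `|g|`.

With `u` of class `C^3` the gradient is `C^2`, as the Ricci identity requires. On the manifold it
remains to see that the metric matrix in a chart is smooth and positive definite, up to the
boundary. -/

namespace RiemannCoord

/-! ### Calculus of partial derivatives within a domain -/

section PartialDerivatives

variable {n : ℕ} {S : Set (EuclideanSpace ℝ (Fin n))} {y : EuclideanSpace ℝ (Fin n)}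

theorem pd_congr {u v : EuclideanSpace ℝ (Fin n) → ℝ} (h : Set.EqOn u v S) (hy : y ∈ S)
    (k : Fin n) : pd S k u y = pd S k v y := by
  unfold pd
  rw [fderivWithin_congr h (h hy)]

theorem pd_const (c : ℝ) (k : Fin n) : pd S k (fun _ => c) y = 0 := by
  simp [pd]

theorem pd_add (hS : UniqueDiffOn ℝ S) (hy : y ∈ S) {u v : EuclideanSpace ℝ (Fin n) → ℝ}
    (hu : DifferentiableOn ℝ u S) (hv : DifferentiableOn ℝ v S) (k : Fin n) :
    pd S k (fun z => u z + v z) y = pd S k u y + pd S k v y := by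
  unfold pd
  rw [fderivWithin_fun_add (hS y hy) (hu y hy) (hv y hy)]
  rfl

theorem pd_mul (hS : UniqueDiffOn ℝ S) (hy : y ∈ S) {u v : EuclideanSpace ℝ (Fin n) → ℝ}
    (hu : DifferentiableOn ℝ u S) (hv : DifferentiableOn ℝ v S) (k : Fin n) :
    pd S k (fun z => u z * v z) y = pd S k u y * v y + u y * pd S k v y := by
  unfold pd
  rw [fderivWithin_fun_mul (hS y hy) (hu y hy) (hv y hy)]
  simp
  ring

theorem pd_sum (hS : UniqueDiffOn ℝ S) (hy : y ∈ S) {ι : Type*} {s : Finset ι}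
    {u : ι → EuclideanSpace ℝ (Fin n) → ℝ} (hu : ∀ i ∈ s, DifferentiableOn ℝ (u i) S) (k : Fin n) :
    pd S k (fun z => ∑ i ∈ s, u i z) y = ∑ i ∈ s, pd S k (u i) y := by
  unfold pd
  rw [fderivWithin_fun_sum (hS y hy) (fun i hi => hu i hi y hy)]
  simp

theorem pd_sum_mul (hS : UniqueDiffOn ℝ S) (hy : y ∈ S) {ι : Type*} {s : Finset ι}
    {u v : ι → EuclideanSpace ℝ (Fin n) → ℝ} (hu : ∀ i, DifferentiableOn ℝ (u i) S)
    (hv : ∀ i, DifferentiableOn ℝ (v i) S) (k : Fin n) :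
    pd S k (fun z => ∑ i ∈ s, u i z * v i z) y
      = ∑ i ∈ s, pd S k (u i) y * v i y + ∑ i ∈ s, u i y * pd S k (v i) y := by
  rw [pd_sum hS hy (u := fun i z => u i z * v i z) (fun i _ => (hu i).mul (hv i)),
    ← Finset.sum_add_distrib]
  exact Finset.sum_congr rfl fun i _ => pd_mul hS hy (hu i) (hv i) k

theorem contDiffOn_pd (hS : UniqueDiffOn ℝ S) {u : EuclideanSpace ℝ (Fin n) → ℝ}
    {m m' : WithTop ℕ∞} (hu : ContDiffOn ℝ m' u S) (hm : m + 1 ≤ m') (k : Fin n) :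
    ContDiffOn ℝ m (pd S k u) S :=
  (hu.fderivWithin hS hm).clm_apply contDiffOn_const

/-- Symmetry of second derivatives extends to boundary points because they are limits of interior
points. -/
theorem pd_comm (hS : UniqueDiffOn ℝ S) (hS' : S ⊆ closure (interior S)) (hy : y ∈ S)
    {u : EuclideanSpace ℝ (Fin n) → ℝ} (hu : ContDiffOn ℝ 2 u S) (j k : Fin n) :
    pd S j (pd S k u) y = pd S k (pd S j u) y := by
  have hd : DifferentiableWithinAt ℝ (fderivWithin ℝ u S) S y :=
    (hu.fderivWithin hS (m := 1) (by norm_num)).differentiableOn (by norm_num) y hy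
  have key : ∀ j k : Fin n, pd S j (pd S k u) y =
      fderivWithin ℝ (fderivWithin ℝ u S) S y (EuclideanSpace.single j 1)
        (EuclideanSpace.single k 1) := by
    intro j k
    change fderivWithin ℝ (fun z => fderivWithin ℝ u S z (EuclideanSpace.single k 1)) S y _ = _
    rw [fderivWithin_clm_apply (hS y hy) hd (differentiableWithinAt_const _)]
    simp
  rw [key, key]
  exact (hu y hy).isSymmSndFDerivWithinAt (by simp) hS (hS' hy) hy _ _

/-- Jacobi's formula. The Leibniz expansion is differentiated one column at a time; by Cramer's
rule, row `a` of the adjugate paired with the derivative of column `a` is the determinant with that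
column replaced. -/
theorem pd_det (hS : UniqueDiffOn ℝ S) (hy : y ∈ S)
    {G : EuclideanSpace ℝ (Fin n) → Matrix (Fin n) (Fin n) ℝ}
    (hG : ∀ a b, DifferentiableOn ℝ (fun z => G z a b) S) (k : Fin n) :
    pd S k (fun z => (G z).det) y
      = ∑ a, ∑ b, (G y).adjugate a b * pd S k (fun z => G z b a) y := by
  have h1 : ∀ σ : Equiv.Perm (Fin n), DifferentiableOn ℝ (fun z => ∏ i, G z (σ i) i) S :=
    fun σ z hz =>
      (HasFDerivWithinAt.finsetProd fun i _ => (hG _ _ z hz).hasFDerivWithinAt).differentiableWithinAt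
  have h2 : ∀ σ : Equiv.Perm (Fin n), pd S k (fun z => ∏ i, G z (σ i) i) y
      = ∑ i, (∏ l ∈ Finset.univ.erase i, G y (σ l) l) * pd S k (fun z => G z (σ i) i) y := by
    intro σ
    unfold pd
    rw [fderivWithin_finsetProd (hS y hy) (fun i _ => hG _ _ y hy)]
    simp
  simp only [Matrix.det_apply']
  rw [pd_sum hS hy
    (u := fun (σ : Equiv.Perm (Fin n)) z => (Equiv.Perm.sign σ : ℤ) * ∏ i, G z (σ i) i)
    fun σ _ => (differentiableOn_const _).mul (h1 σ)]
  have h3 : ∀ a, ∑ b, (G y).adjugate a b * pd S k (fun z => G z b a) y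
      = ((G y).updateCol a fun b => pd S k (fun z => G z b a) y).det := by
    intro a
    rw [← Matrix.cramer_apply, Matrix.cramer_eq_adjugate_mulVec]
    rfl
  simp only [h3, Matrix.det_apply']
  rw [Finset.sum_comm]
  refine Finset.sum_congr rfl fun σ _ => ?_
  rw [pd_mul hS hy (differentiableOn_const _) (h1 σ), pd_const, h2, zero_mul, zero_add,
    ← Finset.mul_sum]
  congr 1
  refine Finset.sum_congr rfl fun i _ => ?_
  rw [← Finset.prod_erase_mul _ _ (Finset.mem_univ i)]
  congr 1
  · refine Finset.prod_congr rfl fun l hl => ?_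
    rw [Matrix.updateCol_ne (Finset.ne_of_mem_erase hl)]
  · rw [Matrix.updateCol_self]

end PartialDerivatives

end RiemannCoord

/-! ### Metric, connection and divergence in coordinates -/

namespace RiemannCoord

/-- `G` is the matrix of a smooth Riemannian metric on the coordinate domain `S`. -/
structure IsMetricOn {n : ℕ} (S : Set (EuclideanSpace ℝ (Fin n)))
    (G : EuclideanSpace ℝ (Fin n) → Matrix (Fin n) (Fin n) ℝ) : Prop where
  uniqueDiffOn : UniqueDiffOn ℝ S
  subset_closure_interior : S ⊆ closure (interior S)
  contDiffOn : ∀ a b, ContDiffOn ℝ ∞ (fun z => G z a b) S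
  posDef : ∀ y ∈ S, (G y).PosDef

section Metric

variable {n : ℕ} {S : Set (EuclideanSpace ℝ (Fin n))} {y : EuclideanSpace ℝ (Fin n)}
  {G : EuclideanSpace ℝ (Fin n) → Matrix (Fin n) (Fin n) ℝ}

theorem contDiffOn_det {m : WithTop ℕ∞} (hG : ∀ a b, ContDiffOn ℝ m (fun z => G z a b) S) :
    ContDiffOn ℝ m (fun z => (G z).det) S := by
  simp only [Matrix.det_apply']
  exact ContDiffOn.sum fun σ _ => contDiffOn_const.mul (contDiffOn_prod fun i _ => hG _ _)

theorem contDiffOn_adjugate {m : WithTop ℕ∞} (hG : ∀ a b, ContDiffOn ℝ m (fun z => G z a b) S)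
    (a b : Fin n) : ContDiffOn ℝ m (fun z => (G z).adjugate a b) S := by
  simp only [Matrix.adjugate_apply]
  refine contDiffOn_det fun c d => ?_
  simp only [Matrix.updateRow_apply]
  split_ifs
  · exact contDiffOn_const
  · exact hG _ _

theorem ginv_eq (a b : Fin n) :
    ginv G a b y = ((G y).det)⁻¹ * (G y).adjugate a b := by
  simp [ginv, Matrix.inv_def]

theorem riemann_eq (j k l m : Fin n) :
    riemann S G j k l m y
      = (pd S l (christoffel S G j k m) y
          + ∑ a, christoffel S G j a l y * christoffel S G a k m y)
        - (pd S m (christoffel S G j k l) y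
          + ∑ a, christoffel S G j a m y * christoffel S G a k l y) := by
  have e : ∀ m, covDeriv S G m (coordField k) = fun j => christoffel S G j k m := by
    intro m
    ext j z
    have : pd S m (coordField k j) z = 0 := pd_const _ _
    simp [covDeriv, this, coordField]
  simp only [riemann, e]
  rfl

namespace IsMetricOn

variable (h : IsMetricOn S G)

include h

theorem symm (hy : y ∈ S) (a b : Fin n) : G y a b = G y b a := by
  simpa using (h.posDef y hy).isHermitian.apply b a

theorem det_pos (hy : y ∈ S) : 0 < (G y).det := (h.posDef y hy).det_pos

theorem contDiffOn_ginv (a b : Fin n) : ContDiffOn ℝ ∞ (ginv G a b) S :=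
  (((contDiffOn_det h.contDiffOn).inv fun _ hz => (h.det_pos hz).ne').mul
    (contDiffOn_adjugate h.contDiffOn a b)).congr fun _ _ => ginv_eq a b

theorem ginv_symm (hy : y ∈ S) (a b : Fin n) : ginv G a b y = ginv G b a y := by
  simpa [ginv] using (h.posDef y hy).isHermitian.inv.apply b a

theorem contDiffOn_christoffel (j l k : Fin n) : ContDiffOn ℝ ∞ (christoffel S G j l k) S := by
  have hp : ∀ a b c, ContDiffOn ℝ ∞ (pd S a fun z => G z b c) S := fun a b c =>
    contDiffOn_pd h.uniqueDiffOn (h.contDiffOn b c) (by simp) a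
  exact contDiffOn_const.mul (ContDiffOn.sum fun m _ =>
    (h.contDiffOn_ginv j m).mul (((hp _ _ _).add (hp _ _ _)).sub (hp _ _ _)))

theorem pd_symm (hy : y ∈ S) (k a b : Fin n) :
    pd S k (fun z => G z a b) y = pd S k (fun z => G z b a) y :=
  pd_congr (fun _ hz => h.symm hz a b) hy k

theorem christoffel_symm (hy : y ∈ S) (j l k : Fin n) :
    christoffel S G j l k y = christoffel S G j k l y := by
  unfold christoffel
  congr 1
  refine Finset.sum_congr rfl fun m _ => ?_
  rw [h.pd_symm hy m l k]
  ring

/-- The inverse metric is parallel. -/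
theorem pd_ginv (hy : y ∈ S) (k a b : Fin n) :
    pd S k (ginv G a b) y = -∑ s, christoffel S G a s k y * ginv G s b y
      - ∑ s, ginv G a s y * christoffel S G b s k y := by
  let P : Matrix (Fin n) (Fin n) ℝ := .of fun c d => pd S k (ginv G c d) y
  let D : Matrix (Fin n) (Fin n) ℝ := .of fun c d => pd S k (fun z => G z c d) y
  -- Twice the Christoffel symbols with the upper index lowered. Their symmetric part `hC` is metric
  -- compatibility; `hP` differentiates `G⁻¹ G = 1`.
  let C : Matrix (Fin n) (Fin n) ℝ := .of fun m l =>
    pd S l (fun z => G z k m) y + pd S k (fun z => G z l m) y - pd S m (fun z => G z l k) y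
  let Γ : Matrix (Fin n) (Fin n) ℝ := .of fun c s => christoffel S G c s k y
  have hdet : IsUnit (G y).det := (h.det_pos hy).ne'.isUnit
  have hΓ : Γ = (1 / 2 : ℝ) • ((G y)⁻¹ * C) := by
    ext c s
    simp [Γ, C, christoffel, Matrix.mul_apply, ginv]
  have hC : C + C.transpose = (2 : ℝ) • D := by
    ext c d
    simp only [C, D, Matrix.add_apply, Matrix.transpose_apply, Matrix.of_apply, Matrix.smul_apply,
      smul_eq_mul]
    rw [h.pd_symm hy d k c, h.pd_symm hy c d k, h.pd_symm hy k d c]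
    ring
  have hP : P * G y + (G y)⁻¹ * D = 0 := by
    ext c d
    have h1 : Set.EqOn (fun z => ∑ e, ginv G c e z * G z e d)
        (fun _ => (1 : Matrix (Fin n) (Fin n) ℝ) c d) S := by
      intro z hz
      have := congrFun₂ (Matrix.nonsing_inv_mul (G z) (h.det_pos hz).ne'.isUnit) c d
      simpa [Matrix.mul_apply, ginv] using this
    have h2 := pd_congr h1 hy k
    rw [pd_const, pd_sum_mul h.uniqueDiffOn hy
      (fun e => (h.contDiffOn_ginv c e).differentiableOn (by simp))
      (v := fun e z => G z e d)
      (fun e => (h.contDiffOn e d).differentiableOn (by simp))] at h2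
    simpa [Matrix.mul_apply, P, D, ginv] using h2
  have hsymm : ((G y)⁻¹).transpose = (G y)⁻¹ := by
    ext c d
    exact h.ginv_symm hy d c
  have hP' : P = -(Γ * (G y)⁻¹) - (G y)⁻¹ * Γ.transpose := by
    have h1 : P = -((G y)⁻¹ * D * (G y)⁻¹) := by
      rw [← Matrix.mul_nonsing_inv_cancel_right (A := G y) P hdet, eq_neg_of_add_eq_zero_left hP,
        Matrix.neg_mul]
    have h2 : D = (1 / 2 : ℝ) • (C + C.transpose) := by
      rw [hC, smul_smul]
      norm_num
    rw [h1, h2, hΓ, Matrix.transpose_smul, Matrix.transpose_mul, hsymm]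
    simp only [Matrix.mul_smul, Matrix.smul_mul, Matrix.mul_add, Matrix.add_mul, Matrix.mul_assoc,
      smul_add]
    abel
  have := congrFun₂ hP' a b
  simpa [Matrix.mul_apply, P, Γ, ginv] using this

/-- Two of the three metric derivatives cancel by symmetry of `g^{km}`; the third is Jacobi's
formula. -/
theorem sum_christoffel (hy : y ∈ S) (s : Fin n) :
    ∑ k, christoffel S G k s k y = 1 / 2 * ((G y).det)⁻¹ * pd S s (fun z => (G z).det) y := by
  rw [pd_det h.uniqueDiffOn hy (fun a b => (h.contDiffOn a b).differentiableOn (by simp))]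
  simp only [christoffel]
  rw [← Finset.mul_sum, mul_assoc]
  congr 1
  simp only [mul_sub, mul_add, Finset.sum_sub_distrib, Finset.sum_add_distrib]
  have e : ∑ k, ∑ m, ginv G k m y * pd S m (fun z => G z s k) y
      = ∑ k, ∑ m, ginv G k m y * pd S k (fun z => G z s m) y := by
    rw [Finset.sum_comm]
    refine Finset.sum_congr rfl fun k _ => Finset.sum_congr rfl fun m _ => ?_
    rw [h.ginv_symm hy]
  rw [e, add_sub_cancel_right, Finset.mul_sum]
  refine Finset.sum_congr rfl fun k _ => ?_
  rw [Finset.mul_sum]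
  refine Finset.sum_congr rfl fun m _ => ?_
  rw [ginv_eq, h.pd_symm hy s k m, mul_assoc]

theorem divergence_eq (hy : y ∈ S) {X : Fin n → EuclideanSpace ℝ (Fin n) → ℝ}
    (hX : ∀ j, DifferentiableOn ℝ (X j) S) :
    divergence S G X y = ∑ k, covDeriv S G k X k y := by
  have hd : DifferentiableOn ℝ (fun z => (G z).det) S :=
    (contDiffOn_det h.contDiffOn).differentiableOn (by simp)
  have hs : DifferentiableOn ℝ (fun z => √(G z).det) S :=
    hd.sqrt fun z hz => (h.det_pos hz).ne'
  have hp := h.det_pos hy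
  have hsq : √(G y).det ≠ 0 := (Real.sqrt_pos.2 hp).ne'
  have hps : ∀ j, pd S j (fun z => √(G z).det) y
      = √(G y).det * ∑ k, christoffel S G k j k y := by
    intro j
    rw [h.sum_christoffel hy]
    have : pd S j (fun z => √(G z).det) y
        = 1 / (2 * √(G y).det) * pd S j (fun z => (G z).det) y := by
      unfold pd
      rw [fderivWithin_sqrt (hd y hy) hp.ne' (h.uniqueDiffOn y hy)]
      simp
    rw [this]
    -- Only the determinant under `⁻¹` becomes a square, so that `√|g| · |g|⁻¹` reduces to `1 /
    -- √|g|`.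
    nth_rewrite 3 [← Real.sq_sqrt hp.le]
    field_simp
  unfold divergence covDeriv
  rw [Finset.sum_add_distrib, Finset.sum_comm (f := fun k l => christoffel S G k l k y * X l y),
    ← Finset.sum_add_distrib, Finset.mul_sum]
  refine Finset.sum_congr rfl fun j _ => ?_
  rw [pd_mul h.uniqueDiffOn hy hs (hX j), hps, ← Finset.sum_mul]
  field_simp
  ring

/-! ### Hessian, Ricci identity and Bochner formula -/

theorem contDiffOn_covDeriv {X : Fin n → EuclideanSpace ℝ (Fin n) → ℝ} {m m' : WithTop ℕ∞}
    (hX : ∀ j, ContDiffOn ℝ m' (X j) S) (hm : m + 1 ≤ m') (hm' : m ≤ ∞) (k j : Fin n) :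
    ContDiffOn ℝ m (covDeriv S G k X j) S :=
  (contDiffOn_pd h.uniqueDiffOn (hX j) hm k).add (ContDiffOn.sum fun l _ =>
    ((h.contDiffOn_christoffel j l k).of_le hm').mul ((hX l).of_le (le_self_add.trans hm)))

theorem contDiffOn_grad {u : EuclideanSpace ℝ (Fin n) → ℝ} {m m' : WithTop ℕ∞}
    (hu : ContDiffOn ℝ m' u S) (hm : m + 1 ≤ m') (hm' : m ≤ ∞) (j : Fin n) :
    ContDiffOn ℝ m (grad S G u j) S :=
  ContDiffOn.sum fun l _ =>
    ((h.contDiffOn_ginv j l).of_le hm').mul (contDiffOn_pd h.uniqueDiffOn hu hm l)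

/-- The covariant derivative of the gradient is the Hessian with one index raised. -/
theorem covDeriv_grad (hy : y ∈ S) {u : EuclideanSpace ℝ (Fin n) → ℝ} (hu : ContDiffOn ℝ 2 u S)
    (l j : Fin n) :
    covDeriv S G l (grad S G u) j y = ∑ a, ginv G j a y *
      (pd S l (pd S a u) y - ∑ s, christoffel S G s a l y * pd S s u y) := by
  have h1 : pd S l (grad S G u j) y
      = ∑ a, pd S l (ginv G j a) y * pd S a u y + ∑ a, ginv G j a y * pd S l (pd S a u) y :=
    pd_sum_mul h.uniqueDiffOn hy (fun a => (h.contDiffOn_ginv j a).differentiableOn (by simp))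
      (fun a => (contDiffOn_pd h.uniqueDiffOn hu (m := 1) (by norm_num) a).differentiableOn
        (by simp)) l
  unfold covDeriv
  rw [h1]
  -- Of the two sums from `pd_ginv`, one cancels the connection term of `covDeriv` and the other
  -- gives the Christoffel term of the Hessian.
  simp only [h.pd_ginv hy, grad, sub_mul, neg_mul, Finset.sum_mul, mul_sub, Finset.mul_sum,
    Finset.sum_sub_distrib, Finset.sum_neg_distrib]
  rw [Finset.sum_comm (f := fun a s => christoffel S G j s l y * ginv G s a y * pd S a u y),
    Finset.sum_comm (f := fun a s => ginv G j s y * christoffel S G a s l y * pd S a u y)]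
  simp only [mul_assoc]
  ring

theorem covDerivUp_grad_symm (hy : y ∈ S) {u : EuclideanSpace ℝ (Fin n) → ℝ}
    (hu : ContDiffOn ℝ 2 u S) (j m : Fin n) :
    covDerivUp S G (grad S G u) j m y = covDerivUp S G (grad S G u) m j y := by
  simp only [covDerivUp, h.covDeriv_grad hy hu, Finset.mul_sum]
  rw [Finset.sum_comm]
  refine Finset.sum_congr rfl fun a _ => Finset.sum_congr rfl fun l _ => ?_
  rw [pd_comm h.uniqueDiffOn h.subset_closure_interior hy hu l a]
  simp only [h.christoffel_symm hy _ a l]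
  ring

/-- The Ricci identity for vector fields. -/
theorem covDeriv_comm (hy : y ∈ S) {X : Fin n → EuclideanSpace ℝ (Fin n) → ℝ}
    (hX : ∀ j, ContDiffOn ℝ 2 (X j) S) (j k l : Fin n) :
    covDeriv S G k (covDeriv S G l X) j y
      = covDeriv S G l (covDeriv S G k X) j y + ∑ s, riemann S G j s k l y * X s y := by
  -- Exchanging `k` and `l` swaps the two sums with first derivatives of `X`, so only zeroth-order
  -- terms survive in the commutator.
  have key : ∀ k l, covDeriv S G k (covDeriv S G l X) j y
      = pd S k (pd S l (X j)) y + ∑ s, pd S k (christoffel S G j s l) y * X s y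
        + ∑ s, christoffel S G j s l y * pd S k (X s) y
        + ∑ s, christoffel S G j s k y * pd S l (X s) y
        + ∑ s, (∑ a, christoffel S G j a k y * christoffel S G a s l y) * X s y := by
    intro k l
    have hΓ : ∀ s, DifferentiableOn ℝ (christoffel S G j s l) S := fun s =>
      (h.contDiffOn_christoffel j s l).differentiableOn (by simp)
    have hX' : ∀ s, DifferentiableOn ℝ (X s) S := fun s => (hX s).differentiableOn (by simp)
    have h1 : pd S k (covDeriv S G l X j) y = pd S k (pd S l (X j)) y
        + (∑ s, pd S k (christoffel S G j s l) y * X s y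
        + ∑ s, christoffel S G j s l y * pd S k (X s) y) := by
      rw [← pd_sum_mul h.uniqueDiffOn hy hΓ hX']
      exact pd_add h.uniqueDiffOn hy
        ((contDiffOn_pd h.uniqueDiffOn (hX j) (m := 1) (by norm_num) l).differentiableOn (by simp))
        (DifferentiableOn.fun_sum fun s _ => (hΓ s).mul (hX' s)) k
    rw [covDeriv, h1]
    simp only [covDeriv, mul_add, Finset.sum_add_distrib, Finset.mul_sum, Finset.sum_mul]
    rw [Finset.sum_comm (f := fun s a => christoffel S G j a k y * christoffel S G a s l y * X s y)]
    simp only [mul_assoc]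
    ring
  rw [key k l, key l k, pd_comm h.uniqueDiffOn h.subset_closure_interior hy (hX j) k l]
  simp only [riemann_eq, sub_mul, add_mul, Finset.sum_sub_distrib, Finset.sum_add_distrib]
  ring

/-- Symmetry moves the contraction onto the index of `X`, and the parallel factor `g^{jl}` comes
out. As `covDeriv` treats `l` as a label, the connection term of that lower index appears
explicitly. -/
theorem vectorLaplacian_eq_of_symm (hy : y ∈ S) {X : Fin n → EuclideanSpace ℝ (Fin n) → ℝ}
    (hX : ∀ j, ContDiffOn ℝ 2 (X j) S)
    (hsymm : ∀ z ∈ S, ∀ j m, covDerivUp S G X j m z = covDerivUp S G X m j z) (j : Fin n) :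
    vectorLaplacian S G X j y = ∑ l, ginv G j l y * ∑ k, (covDeriv S G k (covDeriv S G l X) k y
      - ∑ s, christoffel S G s l k y * covDeriv S G s X k y) := by
  have hY : ∀ l k, DifferentiableOn ℝ (covDeriv S G l X k) S := fun l k =>
    (h.contDiffOn_covDeriv hX (m := 1) (by norm_num) (by simp) l k).differentiableOn (by simp)
  have h1 : ∀ k, pd S k (covDerivUp S G X j k) y
      = ∑ l, pd S k (ginv G j l) y * covDeriv S G l X k y
        + ∑ l, ginv G j l y * pd S k (covDeriv S G l X k) y := by
    intro k
    rw [pd_congr (fun z hz => hsymm z hz j k) hy]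
    exact pd_sum_mul h.uniqueDiffOn hy
      (fun l => (h.contDiffOn_ginv j l).differentiableOn (by simp)) (fun l => hY l k) k
  have h2 : ∀ k l, covDeriv S G k (covDeriv S G l X) k y
      = pd S k (covDeriv S G l X k) y + ∑ a, christoffel S G k a k y * covDeriv S G l X a y :=
    fun k l => rfl
  simp only [h2, Finset.mul_sum]
  rw [Finset.sum_comm]
  unfold vectorLaplacian covDeriv₂
  refine Finset.sum_congr rfl fun k _ => ?_
  rw [h1]
  -- The free index is now the raised one, so the `Γ^j` terms cancel against the derivative of
  -- `g^{jl}`.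
  simp only [fun l => hsymm y hy l k, fun l => hsymm y hy j l]
  simp only [covDerivUp, h.pd_ginv hy, sub_mul, neg_mul, Finset.sum_mul, mul_sub, mul_add,
    Finset.mul_sum, Finset.sum_sub_distrib, Finset.sum_neg_distrib, Finset.sum_add_distrib]
  rw [Finset.sum_comm (f := fun l s =>
      christoffel S G j s k y * ginv G s l y * covDeriv S G l X k y),
    Finset.sum_comm (f := fun l s =>
      ginv G j s y * christoffel S G l s k y * covDeriv S G l X k y),
    Finset.sum_comm (f := fun l a =>
      christoffel S G k l k y * (ginv G j a y * covDeriv S G a X l y))]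
  simp only [mul_assoc, mul_left_comm (ginv G j _ y)]
  ring

/-- The Bochner formula `Δ ∇u = ∇ Δu + Ric(∇u)`. -/
theorem vectorLaplacian_grad (hy : y ∈ S) {u : EuclideanSpace ℝ (Fin n) → ℝ}
    (hu : ContDiffOn ℝ 3 u S) (j : Fin n) :
    vectorLaplacian S G (grad S G u) j y = grad S G (laplaceBeltrami S G u) j y
      + ∑ l, ricciUp S G l j y * grad S G u l y := by
  have hX : ∀ j, ContDiffOn ℝ 2 (grad S G u j) S :=
    h.contDiffOn_grad hu (by norm_num) (WithTop.coe_le_coe.2 le_top)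
  have hY : ∀ l k, DifferentiableOn ℝ (covDeriv S G l (grad S G u) k) S := fun l k =>
    (h.contDiffOn_covDeriv hX (m := 1) (by norm_num) (by simp) l k).differentiableOn (by simp)
  rw [h.vectorLaplacian_eq_of_symm hy hX fun z hz j m =>
    h.covDerivUp_grad_symm hz (hu.of_le (by norm_num)) j m]
  have h1 : ∀ l, pd S l (laplaceBeltrami S G u) y
      = ∑ k, pd S l (covDeriv S G k (grad S G u) k) y := by
    intro l
    rw [← pd_sum h.uniqueDiffOn hy (fun k _ => hY k k)]
    exact pd_congr (fun z hz => h.divergence_eq hz fun j => (hX j).differentiableOn (by simp)) hy l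
  have h2 : ∑ l, ricciUp S G l j y * grad S G u l y
      = ∑ l, ginv G j l y * ∑ k, ∑ s, riemann S G k s k l y * grad S G u s y := by
    simp only [ricciUp, ricci, Finset.sum_mul, Finset.mul_sum]
    rw [Finset.sum_comm]
    refine Finset.sum_congr rfl fun l _ => ?_
    rw [Finset.sum_comm]
    simp only [mul_assoc]
  rw [grad, h2, ← Finset.sum_add_distrib]
  refine Finset.sum_congr rfl fun l _ => ?_
  rw [h1, ← mul_add]
  congr 1
  simp only [fun k => h.covDeriv_comm hy hX k k l, Finset.sum_sub_distrib, Finset.sum_add_distrib]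
  -- The connection term of the upper index, relabelled, is exactly the correction for the lower
  -- index `l`; the two cancel and leave `∂_l` of the divergence.
  have h3 : ∑ k, covDeriv S G l (covDeriv S G k (grad S G u)) k y
      = ∑ k, pd S l (covDeriv S G k (grad S G u) k) y
        + ∑ k, ∑ s, christoffel S G s l k y * covDeriv S G s (grad S G u) k y := by
    rw [Finset.sum_comm (f := fun k s =>
      christoffel S G s l k y * covDeriv S G s (grad S G u) k y), ← Finset.sum_add_distrib]
    simp only [h.christoffel_symm hy _ l]
    rfl
  rw [h3]
  ring

end IsMetricOn

end Metric

end RiemannCoord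

/-! ### The metric matrix in a chart -/

section Manifold

variable {n : ℕ} {H : Type*} [TopologicalSpace H]
  {I : ModelWithCorners ℝ (EuclideanSpace ℝ (Fin n)) H}
  {M : Type*} [TopologicalSpace M]

theorem uniqueDiffOn_extend_target (φ : OpenPartialHomeomorph M H) :
    UniqueDiffOn ℝ (φ.extend I).target := by
  rw [φ.extend_target]
  exact I.uniqueDiffOn_preimage φ.open_target

/-- The target is the range of `I` cut by an open set, and the range lies in the closure of its
interior. -/
theorem extend_target_subset_closure_interior (φ : OpenPartialHomeomorph M H) :
    (φ.extend I).target ⊆ closure (interior (φ.extend I).target) := by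
  rw [φ.extend_target, interior_inter,
    (φ.open_target.preimage I.continuous_symm).interior_eq]
  rintro y ⟨hy, hy'⟩
  exact (φ.open_target.preimage I.continuous_symm).inter_closure
    ⟨hy, I.range_subset_closure_interior hy'⟩

variable [ChartedSpace H M] {φ : OpenPartialHomeomorph M H}

theorem contMDiffOn_extend_symm_target (hφ : φ ∈ IsManifold.maximalAtlas I ∞ M) :
    ContMDiffOn 𝓘(ℝ, EuclideanSpace ℝ (Fin n)) I ∞ (φ.extend I).symm (φ.extend I).target := by
  rw [φ.extend_target']
  exact contMDiffOn_extend_symm hφ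

/-- By the chain rule the differential of the chart is a left inverse. -/
theorem mfderivWithin_extend_symm_injective (hφ : φ ∈ IsManifold.maximalAtlas I ∞ M)
    {y : EuclideanSpace ℝ (Fin n)} (hy : y ∈ (φ.extend I).target) :
    Function.Injective (mfderivWithin 𝓘(ℝ, EuclideanSpace ℝ (Fin n)) I (φ.extend I).symm
      (φ.extend I).target y) := by
  have hsrc : (φ.extend I).symm y ∈ φ.source := by
    simpa using (φ.extend I).map_target hy
  have hu : UniqueMDiffWithinAt 𝓘(ℝ, EuclideanSpace ℝ (Fin n)) (φ.extend I).target y :=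
    (uniqueDiffOn_extend_target φ).uniqueMDiffOn y hy
  have h1 : MDifferentiableWithinAt 𝓘(ℝ, EuclideanSpace ℝ (Fin n)) I (φ.extend I).symm
      (φ.extend I).target y :=
    (contMDiffOn_extend_symm_target hφ y hy).mdifferentiableWithinAt (by simp)
  have h2 : MDifferentiableAt I 𝓘(ℝ, EuclideanSpace ℝ (Fin n)) (φ.extend I)
      ((φ.extend I).symm y) :=
    (φ.contMDiffAt_extend hφ hsrc).mdifferentiableAt (by simp)
  have h3 := mfderiv_comp_mfderivWithin y h2 h1 hu
  have h4 : mfderivWithin 𝓘(ℝ, EuclideanSpace ℝ (Fin n)) 𝓘(ℝ, EuclideanSpace ℝ (Fin n))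
      (φ.extend I ∘ (φ.extend I).symm) (φ.extend I).target y
      = ContinuousLinearMap.id ℝ (EuclideanSpace ℝ (Fin n)) := by
    have h5 : fderivWithin ℝ (φ.extend I ∘ (φ.extend I).symm) (φ.extend I).target y
        = fderivWithin ℝ id (φ.extend I).target y :=
      fderivWithin_congr (fun z hz => (φ.extend I).right_inv hz) ((φ.extend I).right_inv hy)
    exact mfderivWithin_eq_fderivWithin.trans
      (h5.trans (fderivWithin_id (uniqueDiffOn_extend_target φ y hy)))
  intro v w hvw
  have h5 : ∀ v : EuclideanSpace ℝ (Fin n), v = mfderiv I 𝓘(ℝ, EuclideanSpace ℝ (Fin n))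
      (φ.extend I) ((φ.extend I).symm y) (mfderivWithin 𝓘(ℝ, EuclideanSpace ℝ (Fin n)) I
        (φ.extend I).symm (φ.extend I).target y v) := fun v =>
    (DFunLike.congr_fun (h4.symm.trans h3) v)
  exact (h5 v).trans ((congrArg _ hvw).trans (h5 w).symm)

variable [IsManifold I ∞ M]

/-- The tangent map of the inverse chart is applied to a constant vector field; this makes the
coordinate fields smooth. -/
theorem contMDiffOn_mfderivWithin_extend_symm (hφ : φ ∈ IsManifold.maximalAtlas I ∞ M)
    (v : EuclideanSpace ℝ (Fin n)) :
    ContMDiffOn 𝓘(ℝ, EuclideanSpace ℝ (Fin n)) I.tangent ∞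
      (fun y => (⟨(φ.extend I).symm y, mfderivWithin 𝓘(ℝ, EuclideanSpace ℝ (Fin n)) I
        (φ.extend I).symm (φ.extend I).target y v⟩ : TangentBundle I M)) (φ.extend I).target := by
  have h := (contMDiffOn_extend_symm_target hφ).contMDiffOn_tangentMapWithin (m := ∞) (by simp)
    (uniqueDiffOn_extend_target φ).uniqueMDiffOn
  have hv : ContMDiff 𝓘(ℝ, EuclideanSpace ℝ (Fin n)) 𝓘(ℝ, EuclideanSpace ℝ (Fin n)).tangent ∞
      (fun y => (⟨y, v⟩ : TangentBundle 𝓘(ℝ, EuclideanSpace ℝ (Fin n))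
        (EuclideanSpace ℝ (Fin n)))) :=
    contMDiff_vectorSpace_iff_contDiff.2 contDiff_const
  exact h.comp hv.contMDiffOn fun y hy => hy

variable (g : Bundle.ContMDiffRiemannianMetric I ∞ (EuclideanSpace ℝ (Fin n))
    (fun p : M => TangentSpace I p))

theorem contDiffOn_metricMatrix (hφ : φ ∈ IsManifold.maximalAtlas I ∞ M) (a b : Fin n) :
    ContDiffOn ℝ ∞ (fun y => metricMatrix g φ y a b) (φ.extend I).target := by
  rw [← contMDiffOn_iff_contDiffOn]
  intro y hy
  have h1 := contMDiffOn_mfderivWithin_extend_symm hφ (EuclideanSpace.single a (1 : ℝ)) y hy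
  have h2 := contMDiffOn_mfderivWithin_extend_symm hφ (EuclideanSpace.single b (1 : ℝ)) y hy
  have h3 := g.contMDiff.contMDiffAt.comp_contMDiffWithinAt y
    (contMDiffOn_extend_symm_target hφ y hy)
  have h4 := ContMDiffWithinAt.clm_bundle_apply₂ (F₁ := EuclideanSpace ℝ (Fin n))
    (F₂ := EuclideanSpace ℝ (Fin n)) (F₃ := ℝ) (E₃ := Bundle.Trivial M ℝ) h3 h1 h2
  exact (Bundle.contMDiffWithinAt_totalSpace.1 h4).2

theorem posDef_metricMatrix (hφ : φ ∈ IsManifold.maximalAtlas I ∞ M)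
    {y : EuclideanSpace ℝ (Fin n)} (hy : y ∈ (φ.extend I).target) :
    (metricMatrix g φ y).PosDef := by
  refine Matrix.PosDef.of_dotProduct_mulVec_pos ?_ fun v hv => ?_
  · ext a b
    exact g.symm _ _ _
  -- The quadratic form at `v` is `g(L w, L w)` with `w = ∑ v_a e_a`, and `L` is injective.
  · let L := mfderivWithin 𝓘(ℝ, EuclideanSpace ℝ (Fin n)) I (φ.extend I).symm (φ.extend I).target y
    let w : EuclideanSpace ℝ (Fin n) := WithLp.toLp 2 v
    have hw : w = ∑ a, v a • (EuclideanSpace.single a (1 : ℝ) : EuclideanSpace ℝ (Fin n)) := by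
      ext b
      simp [w, Finset.sum_apply, Pi.single_apply]
    have hLw : L w ≠ 0 := by
      intro h0
      have h1 : w = 0 := mfderivWithin_extend_symm_injective hφ hy (h0.trans (map_zero L).symm)
      exact hv (by simpa [w] using h1)
    have hLs : L w = ∑ a, v a • L (EuclideanSpace.single a (1 : ℝ)) := by
      rw [hw]
      exact (map_sum L _ _).trans (Finset.sum_congr rfl fun a _ => map_smul L _ _)
    have hpos := g.pos _ (L w) hLw
    rw [hLs] at hpos
    refine hpos.trans_eq ?_
    have h2 : ∀ u, g.inner ((φ.extend I).symm y) (∑ a, v a • L (EuclideanSpace.single a (1 : ℝ))) u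
        = ∑ a, v a * g.inner ((φ.extend I).symm y) (L (EuclideanSpace.single a (1 : ℝ))) u := by
      intro u
      rw [map_sum, sum_apply]
      refine Finset.sum_congr rfl fun a _ => ?_
      rw [map_smul]
      rfl
    refine (h2 _).trans (Finset.sum_congr rfl fun a _ => congrArg (v a * ·) ?_)
    rw [map_sum]
    refine Finset.sum_congr rfl fun b _ => ?_
    rw [map_smul, smul_eq_mul, mul_comm]
    rfl

theorem isMetricOn_metricMatrix (hφ : φ ∈ IsManifold.maximalAtlas I ∞ M) :
    RiemannCoord.IsMetricOn (φ.extend I).target (metricMatrix g φ) where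
  uniqueDiffOn := uniqueDiffOn_extend_target φ
  subset_closure_interior := extend_target_subset_closure_interior φ
  contDiffOn := contDiffOn_metricMatrix g hφ
  posDef _ hy := posDef_metricMatrix g hφ hy

end Manifold

theorem lemma2p1 {n : ℕ} {H : Type*} [TopologicalSpace H]
    (I : ModelWithCorners ℝ (EuclideanSpace ℝ (Fin n)) H)
    {M : Type*} [TopologicalSpace M] [ChartedSpace H M] [IsManifold I ∞ M]
    (g : Bundle.ContMDiffRiemannianMetric I ∞ (EuclideanSpace ℝ (Fin n))
      (fun p : M => TangentSpace I p))
    (f : M → ℝ) (hf : ContMDiff I 𝓘(ℝ, ℝ) 3 f)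
    (φ : OpenPartialHomeomorph M H) (hφ : φ ∈ IsManifold.maximalAtlas I ∞ M)
    (p : M) (hp : p ∈ φ.source) (j : Fin n) :
    let S : Set (EuclideanSpace ℝ (Fin n)) := (φ.extend I).target
    let G : EuclideanSpace ℝ (Fin n) → Matrix (Fin n) (Fin n) ℝ := metricMatrix g φ
    let u : EuclideanSpace ℝ (Fin n) → ℝ := f ∘ (φ.extend I).symm
    let x : EuclideanSpace ℝ (Fin n) := φ.extend I p
    RiemannCoord.vectorLaplacian S G (RiemannCoord.grad S G u) j x
      = RiemannCoord.grad S G (RiemannCoord.laplaceBeltrami S G u) j x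
        + ∑ l, RiemannCoord.ricciUp S G l j x * RiemannCoord.grad S G u l x := by
  intro S G u x
  refine (isMetricOn_metricMatrix g hφ).vectorLaplacian_grad ?_ ?_ j
  · exact (φ.extend I).map_source (by simpa using hp)
  · rw [← contMDiffOn_iff_contDiffOn]
    exact hf.comp_contMDiffOn ((contMDiffOn_extend_symm_target hφ).of_le (WithTop.coe_le_coe.2 le_top))
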